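/- Let $V$ be a real Hilbert space and let $K,L\subset V$ be closed linear subspaces with $K+L=V$ and $K\cap L=\{0\}$. Let $P$ and $Q$ be the orthogonal projections onto $K$ and $L$. Let $T=\sqrt{(P-Q)^2}$ and let $J$ be the partial isometry in the polar decomposition $P-Q=JT$ (so $\ker J=\ker T$). Let $S:V\to V$ be the linear map with $S(y+z)=y-z$ for $y\in K$, $z\in L$, and let $\Delta=\dfrac{2I-(P+Q)}{P+Q}$, that is, the operator $(2I-(P+Q))(P+Q)^{-1}$ on the range of the injective operator $P+Q$. Adjoints, products and equalities of operators are those of possibly unbounded operators, with their natural domains. Then (a) $SP=P$ and $SQ=-Q$; (b) $S(P+Q)=P-Q$ and $S(P-Q)=P+Q$; (c) $S^*S=\Delta$; (d) $(2I-(P+Q))S=P-Q$; (e) $S^*J=JS$; (f) the polar decomposition of $S$ is $S=J\Delta^{1/2}$; that is, $\Delta^{1/2}$ is a non-negative self-adjoint square root of $\Delta=S^*S$, $J$ is a partial isometry with $\ker J=\ker\Delta^{1/2}$, and $S=J\Delta^{1/2}$. -/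

import Mathlib

noncomputable section

namespace SubspacePair

variable {V : Type*} [NormedAddCommGroup V] [InnerProductSpace ℝ V]

/-- Product `g f` of two possibly unbounded operators, on its natural domain
`{x ∈ D(f) : f x ∈ D(g)}`. -/
def opMul (g f : V →ₗ.[ℝ] V) : V →ₗ.[ℝ] V where
  domain := (g.domain.comap f.toFun).map f.domain.subtype
  toFun :=
    { toFun := fun x => g ⟨f ⟨x, by obtain ⟨y, _, hy⟩ := x.2; exact hy ▸ y.2⟩, by
        obtain ⟨x, y, hy, rfl⟩ := x; exact hy⟩
      map_add' := by
        rintro ⟨_, x, hx, rfl⟩ ⟨_, y, hy, rfl⟩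
        rw [← LinearPMap.map_add]
        congr 1
        exact Subtype.ext (f.map_add x y)
      map_smul' := by
        rintro c ⟨_, x, hx, rfl⟩
        rw [← LinearPMap.map_smul]
        congr 1
        exact Subtype.ext (f.map_smul c x) }

theorem mem_opMul_domain (g f : V →ₗ.[ℝ] V) (x : V) :
    x ∈ (opMul g f).domain ↔ ∃ h : x ∈ f.domain, f ⟨x, h⟩ ∈ g.domain := by
  simp only [opMul, Submodule.mem_map, Submodule.mem_comap]
  constructor
  · rintro ⟨y, hy, rfl⟩
    exact ⟨y.2, hy⟩
  · rintro ⟨h, hx⟩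
    exact ⟨⟨x, h⟩, hx, rfl⟩

theorem opMul_apply (g f : V →ₗ.[ℝ] V) (x : (opMul g f).domain)
    (h : (x : V) ∈ f.domain) (h' : f ⟨x, h⟩ ∈ g.domain) :
    opMul g f x = g ⟨f ⟨x, h⟩, h'⟩ := rfl

/-- An everywhere defined linear operator, seen as an operator with domain `V`. -/
def everywhere (A : V →ₗ[ℝ] V) : V →ₗ.[ℝ] V := A.toPMap ⊤

/-- `U` is a partial isometry: it is isometric on the orthogonal complement of its kernel. -/
def IsPartialIsometry (U : V →L[ℝ] V) : Prop :=
  ∀ x ∈ (LinearMap.ker (U : V →ₗ[ℝ] V))ᗮ, ‖U x‖ = ‖x‖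

variable [CompleteSpace V]

/-- `R` is a non-negative self-adjoint square root of the operator `A`. -/
structure IsNonnegSqrt (R A : V →ₗ.[ℝ] V) : Prop where
  selfAdjoint : IsSelfAdjoint R
  nonneg : ∀ x : R.domain, 0 ≤ inner ℝ (x : V) (R x)
  mul_self : opMul R R = A

open Classical in
/-- The non-negative self-adjoint square root `A^{1/2}` of a non-negative self-adjoint operator
(`0` if there is none). -/
def opSqrt (A : V →ₗ.[ℝ] V) : V →ₗ.[ℝ] V :=
  if h : ∃ R, IsNonnegSqrt R A then h.choose else 0

/-- `A = U R` is the polar decomposition of `A`: `R` is the non-negative square root of `A* A`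
and `U` is a partial isometry with the same kernel as `R`. -/
structure IsPolarDecomposition (A : V →ₗ.[ℝ] V) (U : V →L[ℝ] V) (R : V →ₗ.[ℝ] V) : Prop where
  isSqrt : IsNonnegSqrt R (opMul A.adjoint A)
  partialIsometry : IsPartialIsometry U
  ker_eq : ∀ x : V, U x = 0 ↔ ∃ h : x ∈ R.domain, R ⟨x, h⟩ = 0
  eq_mul : A = opMul (everywhere (U : V →ₗ[ℝ] V)) R

/-- The orthogonal projection onto a closed subspace. -/
def proj (K : ClosedSubmodule ℝ V) : V →L[ℝ] V := K.toSubmodule.starProjection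

/-- `T = ((P - Q)²)^{1/2}`. -/
def opT (K L : ClosedSubmodule ℝ V) : V →ₗ.[ℝ] V :=
  opSqrt (everywhere (((proj K - proj L) ^ 2 : V →L[ℝ] V) : V →ₗ[ℝ] V))

open Classical in
/-- The partial isometry `J` of the polar decomposition `P - Q = J T`. -/
def opJ (K L : ClosedSubmodule ℝ V) : V →L[ℝ] V :=
  if h : ∃ U, IsPolarDecomposition
      (everywhere ((proj K - proj L : V →L[ℝ] V) : V →ₗ[ℝ] V)) U (opT K L)
  then h.choose else 0

/-- `Δ = (2 I - (P + Q)) / (P + Q) = (2 I - (P + Q)) (P + Q)⁻¹`, with domain the range of `P + Q`. -/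
def opDelta (K L : ClosedSubmodule ℝ V) : V →ₗ.[ℝ] V :=
  opMul (everywhere ((2 - (proj K + proj L) : V →L[ℝ] V) : V →ₗ[ℝ] V))
    (everywhere ((proj K + proj L : V →L[ℝ] V) : V →ₗ[ℝ] V)).inverse

/-- The operator `S (y + z) = y - z`, `y ∈ K`, `z ∈ L`. -/
def opS (K L : ClosedSubmodule ℝ V) (h : IsCompl K.toSubmodule L.toSubmodule) : V →ₗ[ℝ] V :=
  LinearMap.ofIsCompl h K.toSubmodule.subtype (-L.toSubmodule.subtype)

end SubspacePair

end

open SubspacePair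

noncomputable section
namespace SubspacePair

open ContinuousLinearMap

variable {V : Type*} [NormedAddCommGroup V] [InnerProductSpace ℝ V]

/-! ### Everywhere defined operators -/

/-! Closed complementary subspaces give a bounded `S`, so every operator here turns out to be
bounded and everywhere defined. Checking on `K` and `L` gives `S (P + Q) = P - Q`, `(P - Q) S = 2 -
(P + Q)` and `S² = 1`. With adjoints, `S* S (P + Q) = S* (P - Q) = 2 - (P + Q)`, and likewise on the
other side. Hence `P + Q` has inverse `(1 + S* S) / 2`, `Δ = S* S`, and `P - Q` is invertible. Then
`T` is invertible and `J` is a self-adjoint involution. Since `T` commutes with `(P - Q)²` and its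
commutant, it commutes with `P` and `Q`, whence `S* J = J S`. So `J S` is self-adjoint with square
`S* S`; it is positive because `J S (P + Q) = T`. Uniqueness of roots gives `Δ^{1/2} = J S`.
Existence, uniqueness and commutation of roots rest on `exists_eq_smul_one_sub`. -/

theorem eq_everywhere {R : V →ₗ.[ℝ] V} {A : V →ₗ[ℝ] V}
    (h : ∀ x, ∃ hx : x ∈ R.domain, R ⟨x, hx⟩ = A x) : R = everywhere A := by
  refine LinearPMap.ext (by ext x; simp [everywhere, (h x).1]) fun x _ _ => ?_
  exact (h x).2

theorem everywhere_injective : Function.Injective (everywhere : (V →ₗ[ℝ] V) → (V →ₗ.[ℝ] V)) := by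
  intro A B h
  ext x
  have := LinearPMap.ext_iff.1 h
  exact this.2 (x := x) (hf := trivial) (hg := trivial)

theorem opMul_everywhere (A B : V →ₗ[ℝ] V) :
    opMul (everywhere A) (everywhere B) = everywhere (A ∘ₗ B) :=
  eq_everywhere fun _ => ⟨(mem_opMul_domain _ _ _).2 ⟨trivial, trivial⟩, rfl⟩

/-! ### Inverses of everywhere defined operators -/

theorem eq_zero_of_isUnit {A : V →L[ℝ] V} (hu : IsUnit A) {x : V} (hx : A x = 0) : x = 0 := by
  obtain ⟨B, hB⟩ := hu.exists_left_inv
  calc x = (B * A) x := by rw [hB]; rfl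
    _ = B (A x) := rfl
    _ = 0 := by rw [hx, map_zero]

theorem inverse_everywhere {A B : V →L[ℝ] V} (hAB : A * B = 1) (hBA : B * A = 1) :
    (everywhere (A : V →ₗ[ℝ] V)).inverse = everywhere (B : V →ₗ[ℝ] V) := by
  have hker : LinearMap.ker (everywhere (A : V →ₗ[ℝ] V)).toFun = ⊥ := by
    refine LinearMap.ker_eq_bot'.2 fun x hx => Subtype.ext ?_
    exact eq_zero_of_isUnit ⟨⟨A, B, hAB, hBA⟩, rfl⟩ hx
  refine eq_everywhere fun x => ?_
  have hx : everywhere (A : V →ₗ[ℝ] V) ⟨B x, trivial⟩ = x :=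
    congrArg (fun C : V →L[ℝ] V => C x) hAB
  have hmem : x ∈ (everywhere (A : V →ₗ[ℝ] V)).inverse.domain := by
    rw [LinearPMap.inverse_domain]
    exact ⟨_, hx⟩
  exact ⟨hmem, LinearPMap.inverse_apply_eq hker (y := ⟨x, hmem⟩) (x := ⟨B x, trivial⟩) hx⟩

section

/-! ### The reflection along a pair of complementary subspaces -/

variable {K L : ClosedSubmodule ℝ V} (h : IsCompl K.toSubmodule L.toSubmodule)

theorem opS_apply_left {y : V} (hy : y ∈ K.toSubmodule) : opS K L h y = y :=
  LinearMap.ofIsCompl_apply_left h ⟨y, hy⟩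

theorem opS_apply_right {z : V} (hz : z ∈ L.toSubmodule) : opS K L h z = -z :=
  LinearMap.ofIsCompl_apply_right h ⟨z, hz⟩

theorem continuousLinearMap_ext_of_isCompl (h : IsCompl K.toSubmodule L.toSubmodule)
    {A B : V →L[ℝ] V} (hK : ∀ y ∈ K.toSubmodule, A y = B y) (hL : ∀ z ∈ L.toSubmodule, A z = B z) :
    A = B := by
  ext x
  obtain ⟨y, hy, z, hz, rfl⟩ := Submodule.mem_sup.1 (h.sup_eq_top ▸ Submodule.mem_top : x ∈ _)
  rw [map_add, map_add, hK y hy, hL z hz]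

end

variable [CompleteSpace V]

/-! ### Positive bounded operators -/

theorem inner_apply_left {A : V →L[ℝ] V} (hA : IsSelfAdjoint A) (x y : V) :
    inner ℝ (A x) y = inner ℝ x (A y) := by
  rw [← adjoint_inner_right, ← star_eq_adjoint, hA.star_eq]

/-- A Cauchy-Schwarz inequality for positive operators. -/
theorem norm_apply_sq_le {A : V →L[ℝ] V} (hA : IsSelfAdjoint A) (hpos : ∀ x, 0 ≤ inner ℝ x (A x))
    {M : ℝ} (hM : 0 < M) (hAM : ‖A‖ ≤ M) (x : V) : ‖A x‖ ^ 2 ≤ M * inner ℝ x (A x) := by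
  -- Expands to `M²⟨x, Ax⟩ - 2M‖Ax‖² + ⟨Ax, A²x⟩ ≥ 0`, whose last term is at most `M‖Ax‖²`.
  have h1 := hpos (M • x - A x)
  have h2 : inner ℝ (A x) (A (A x)) ≤ M * ‖A x‖ ^ 2 := by
    calc inner ℝ (A x) (A (A x)) ≤ ‖A x‖ * ‖A (A x)‖ := real_inner_le_norm _ _
      _ ≤ ‖A x‖ * (M * ‖A x‖) := by gcongr; exact A.le_of_opNorm_le hAM _
      _ = M * ‖A x‖ ^ 2 := by ring
  have h3 : inner ℝ x (A (A x)) = ‖A x‖ ^ 2 := by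
    rw [← inner_apply_left hA, real_inner_self_eq_norm_sq]
  simp only [map_sub, map_smul, inner_sub_left, inner_sub_right, inner_smul_left,
    inner_smul_right, h3, real_inner_self_eq_norm_sq, RCLike.conj_to_real] at h1
  have h4 : 0 ≤ M * (M * inner ℝ x (A x) - ‖A x‖ ^ 2) := by nlinarith
  linarith [nonneg_of_mul_nonneg_right h4 hM]

/-- A positive operator bounded below is a multiple of a small perturbation of the identity. -/
theorem exists_eq_smul_one_sub {A : V →L[ℝ] V} (hA : IsSelfAdjoint A) {c : ℝ} (hc : 0 < c)
    (hcoer : ∀ x, c * ‖x‖ ^ 2 ≤ inner ℝ x (A x)) :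
    ∃ M : ℝ, 0 < M ∧ ∃ F : V →L[ℝ] V, IsSelfAdjoint F ∧ ‖F‖ < 1 ∧ A = M • (1 - F) := by
  have hpos : ∀ x, 0 ≤ inner ℝ x (A x) := fun x => le_trans (by positivity) (hcoer x)
  -- Dominates both `‖A‖` and `c`; the resulting bound is `‖F‖² ≤ 1 - c / M`.
  set M := ‖A‖ + c
  have hM : 0 < M := by positivity
  have hcM : c ≤ M := le_add_of_nonneg_left (norm_nonneg A)
  refine ⟨M, hM, 1 - M⁻¹ • A, (IsSelfAdjoint.one _).sub ((IsSelfAdjoint.all _).smul hA), ?_, ?_⟩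
  · have hq : 0 ≤ 1 - c / M := by
      rw [sub_nonneg, div_le_one hM]
      exact hcM
    refine lt_of_le_of_lt (opNorm_le_bound (M := √(1 - c / M)) _ (Real.sqrt_nonneg _) fun x => ?_) ?_
    · rw [← Real.sqrt_sq (norm_nonneg x), ← Real.sqrt_mul hq]
      apply Real.le_sqrt_of_sq_le
      have h1 := norm_apply_sq_le hA hpos hM (le_add_of_nonneg_right hc.le) x
      have h2 : ‖(1 - M⁻¹ • A) x‖ ^ 2 =
          ‖x‖ ^ 2 - 2 * (M⁻¹ * inner ℝ x (A x)) + M⁻¹ ^ 2 * ‖A x‖ ^ 2 := by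
        rw [sub_apply, norm_sub_sq_real]
        simp [inner_smul_right, norm_smul, mul_pow]
      rw [h2]
      have h3 : M⁻¹ ^ 2 * ‖A x‖ ^ 2 ≤ M⁻¹ * inner ℝ x (A x) := by
        calc M⁻¹ ^ 2 * ‖A x‖ ^ 2 ≤ M⁻¹ ^ 2 * (M * inner ℝ x (A x)) := by gcongr
          _ = M⁻¹ * inner ℝ x (A x) := by field_simp
      have h4 : M⁻¹ * (c * ‖x‖ ^ 2) ≤ M⁻¹ * inner ℝ x (A x) := by
        gcongr
        exact hcoer x
      have h5 : (1 - c / M) * ‖x‖ ^ 2 = ‖x‖ ^ 2 - M⁻¹ * (c * ‖x‖ ^ 2) := by ring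
      rw [h5]
      linarith
    · rw [Real.sqrt_lt' one_pos]
      have : 0 < c / M := by positivity
      linarith
  · rw [sub_sub_cancel, smul_smul, mul_inv_cancel₀ hM.ne', one_smul]

/-- The inverse bounds `‖x‖` by `‖A x‖`, and `norm_apply_sq_le` bounds `‖A x‖²` by the quadratic
form. -/
theorem exists_coercive_of_isUnit {A : V →L[ℝ] V} (hA : IsSelfAdjoint A)
    (hpos : ∀ x, 0 ≤ inner ℝ x (A x)) (hu : IsUnit A) :
    ∃ c : ℝ, 0 < c ∧ ∀ x, c * ‖x‖ ^ 2 ≤ inner ℝ x (A x) := by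
  obtain ⟨B, hB⟩ := hu.exists_left_inv
  set M := ‖A‖ + 1
  set N := ‖B‖ + 1
  have hM : 0 < M := by positivity
  have hN : 0 < N := by positivity
  refine ⟨(N ^ 2 * M)⁻¹, by positivity, fun x => ?_⟩
  have h1 := norm_apply_sq_le hA hpos hM (le_add_of_nonneg_right zero_le_one) x
  have h2 : ‖x‖ ≤ N * ‖A x‖ := by
    have := B.le_of_opNorm_le (le_add_of_nonneg_right zero_le_one : ‖B‖ ≤ N) (A x)
    rwa [show B (A x) = (B * A) x from rfl, hB, show (1 : V →L[ℝ] V) x = x from rfl] at this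
  rw [inv_mul_le_iff₀ (by positivity)]
  calc ‖x‖ ^ 2 ≤ (N * ‖A x‖) ^ 2 := by gcongr
    _ = N ^ 2 * ‖A x‖ ^ 2 := by ring
    _ ≤ N ^ 2 * (M * inner ℝ x (A x)) := by gcongr
    _ = _ := by ring

/-- Nothing but zero anticommutes with a positive operator that is bounded below. -/
theorem eq_zero_of_anticommute {A Y : V →L[ℝ] V} (hA : IsSelfAdjoint A) {c : ℝ} (hc : 0 < c)
    (hcoer : ∀ x, c * ‖x‖ ^ 2 ≤ inner ℝ x (A x)) (hY : A * Y + Y * A = 0) : Y = 0 := by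
  obtain ⟨M, hM, F, -, hF, rfl⟩ := exists_eq_smul_one_sub hA hc hcoer
  -- Writing `A = M (1 - F)` turns anticommutation into this equation, which `‖F‖ < 1` allows only
  -- for `Y = 0`.
  have h1 : (2 : ℝ) • Y = F * Y + Y * F := by
    have h2 : M • ((2 : ℝ) • Y - (F * Y + Y * F)) = 0 := by
      rw [← hY, smul_mul_assoc, mul_smul_comm, ← smul_add, two_smul]
      congr 1
      noncomm_ring
    exact sub_eq_zero.1 ((smul_eq_zero_iff_right hM.ne').1 h2)
  have h3 : 2 * ‖Y‖ ≤ 2 * ‖F‖ * ‖Y‖ := by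
    calc 2 * ‖Y‖ = ‖(2 : ℝ) • Y‖ := by simp [norm_smul]
      _ = ‖F * Y + Y * F‖ := by rw [h1]
      _ ≤ ‖F‖ * ‖Y‖ + ‖Y‖ * ‖F‖ :=
        (norm_add_le _ _).trans (add_le_add (norm_mul_le _ _) (norm_mul_le _ _))
      _ = 2 * ‖F‖ * ‖Y‖ := by ring
  by_contra h
  have : 0 < ‖Y‖ := norm_pos_iff.2 h
  nlinarith

/-- The commutator `A X - X A` anticommutes with `A`. -/
theorem commute_of_commute_sq {A X : V →L[ℝ] V} (hA : IsSelfAdjoint A) {c : ℝ} (hc : 0 < c)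
    (hcoer : ∀ x, c * ‖x‖ ^ 2 ≤ inner ℝ x (A x)) (h : A * A * X = X * (A * A)) :
    A * X = X * A := by
  refine sub_eq_zero.1 (eq_zero_of_anticommute hA hc hcoer ?_)
  have : A * (A * X - X * A) + (A * X - X * A) * A = A * A * X - X * (A * A) := by noncomm_ring
  rw [this, h, sub_self]

/-- `A - B` anticommutes with `A + B`, which is coercive as soon as one summand is. -/
theorem eq_of_sq_eq {A B : V →L[ℝ] V} (hA : IsSelfAdjoint A) (hB : IsSelfAdjoint B) {c : ℝ}
    (hc : 0 < c) (hcoer : ∀ x, c * ‖x‖ ^ 2 ≤ inner ℝ x (A x))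
    (hpos : ∀ x, 0 ≤ inner ℝ x (B x)) (h : A * A = B * B) : A = B := by
  refine sub_eq_zero.1 (eq_zero_of_anticommute (hA.add hB) hc (fun x => ?_) (Y := A - B) ?_)
  · rw [add_apply, inner_add_right]
    linarith [hcoer x, hpos x]
  · have : (A + B) * (A - B) + (A - B) * (A + B) = 2 * (A * A - B * B) := by noncomm_ring
    rw [this, h, sub_self, mul_zero]

/-- If `‖F‖ < 1` then `1 - F` has the square root `1 - X` with `X` the fixed point of
`X ↦ (F + X²) / 2`. -/
theorem exists_sqrt_one_sub {F : V →L[ℝ] V} (hF : IsSelfAdjoint F) (hF1 : ‖F‖ < 1) :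
    ∃ X : V →L[ℝ] V, IsSelfAdjoint X ∧ ‖X‖ < 1 ∧ (1 - X) * (1 - X) = 1 - F := by
  let f : (V →L[ℝ] V) → (V →L[ℝ] V) := fun X => (2⁻¹ : ℝ) • (F + X * X)
  -- On this ball the map is `‖F‖`-Lipschitz; intersecting with the closed set of self-adjoint
  -- operators makes the fixed point self-adjoint.
  let s : Set (V →L[ℝ] V) := Metric.closedBall 0 ‖F‖ ∩ {X | IsSelfAdjoint X}
  have hs : IsComplete s :=
    (Metric.isClosed_closedBall.inter (isClosed_eq continuous_star continuous_id)).isComplete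
  have hmaps : Set.MapsTo f s s := by
    rintro X ⟨hX, hX'⟩
    have hX'' : IsSelfAdjoint X := hX'
    rw [mem_closedBall_zero_iff] at hX
    refine ⟨?_, (IsSelfAdjoint.all (2⁻¹ : ℝ)).smul
      (hF.add (by simpa [pow_two] using hX''.pow 2))⟩
    rw [mem_closedBall_zero_iff]
    calc ‖f X‖ = 2⁻¹ * ‖F + X * X‖ := by rw [norm_smul]; norm_num
      _ ≤ 2⁻¹ * (‖F‖ + ‖X‖ * ‖X‖) := by
        gcongr
        exact (norm_add_le _ _).trans (by gcongr; exact norm_mul_le _ _)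
      _ ≤ 2⁻¹ * (‖F‖ + ‖F‖ * 1) := by gcongr; exact hX.trans hF1.le
      _ = ‖F‖ := by ring
  have hcontr : ContractingWith ‖F‖₊ (hmaps.restrict f s s) := by
    refine ⟨by exact_mod_cast hF1, LipschitzWith.of_dist_le_mul ?_⟩
    rintro ⟨X, hX, -⟩ ⟨Y, hY, -⟩
    rw [mem_closedBall_zero_iff] at hX hY
    simp only [Subtype.dist_eq, Set.MapsTo.val_restrict_apply, dist_eq_norm, coe_nnnorm]
    have : f X - f Y = (2⁻¹ : ℝ) • (X * (X - Y) + (X - Y) * Y) := by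
      simp only [f]
      rw [← smul_sub]
      congr 1
      noncomm_ring
    rw [this, norm_smul]
    calc ‖(2⁻¹ : ℝ)‖ * ‖X * (X - Y) + (X - Y) * Y‖
        ≤ ‖(2⁻¹ : ℝ)‖ * (‖X‖ * ‖X - Y‖ + ‖X - Y‖ * ‖Y‖) := by
          gcongr
          exact (norm_add_le _ _).trans (add_le_add (norm_mul_le _ _) (norm_mul_le _ _))
      _ ≤ ‖(2⁻¹ : ℝ)‖ * (‖F‖ * ‖X - Y‖ + ‖X - Y‖ * ‖F‖) := by gcongr
      _ = ‖F‖ * ‖X - Y‖ := by norm_num; ring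
  obtain ⟨X, ⟨hX, hX'⟩, hfix, -⟩ := hcontr.exists_fixedPoint' hs hmaps
    (x := 0) ⟨by simp, IsSelfAdjoint.zero _⟩ (edist_ne_top _ _)
  rw [mem_closedBall_zero_iff] at hX
  refine ⟨X, hX', hX.trans_lt hF1, ?_⟩
  have h2 : F + X * X = (2 : ℝ) • X := by
    have : (2⁻¹ : ℝ) • (F + X * X) = X := hfix
    rw [← this, smul_smul, this]
    norm_num
  have h3 : F = X + X - X * X := by rw [← two_smul ℝ X, ← h2]; abel
  rw [h3]
  noncomm_ring

theorem exists_sqrt_of_coercive {A : V →L[ℝ] V} (hA : IsSelfAdjoint A) {c : ℝ} (hc : 0 < c)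
    (hcoer : ∀ x, c * ‖x‖ ^ 2 ≤ inner ℝ x (A x)) :
    ∃ R : V →L[ℝ] V, IsSelfAdjoint R ∧ (∀ x, 0 ≤ inner ℝ x (R x)) ∧ R * R = A := by
  obtain ⟨M, hM, F, hF, hF1, rfl⟩ := exists_eq_smul_one_sub hA hc hcoer
  obtain ⟨X, hX, hX1, hXX⟩ := exists_sqrt_one_sub hF hF1
  refine ⟨√M • (1 - X), (IsSelfAdjoint.all _).smul ((IsSelfAdjoint.one _).sub hX), fun x => ?_, ?_⟩
  · rw [smul_apply, inner_smul_right, sub_apply, show (1 : V →L[ℝ] V) x = x from rfl, inner_sub_right,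
      real_inner_self_eq_norm_sq]
    have : inner ℝ x (X x) ≤ ‖x‖ ^ 2 := by
      calc inner ℝ x (X x) ≤ ‖x‖ * ‖X x‖ := real_inner_le_norm _ _
        _ ≤ ‖x‖ * (1 * ‖x‖) := by gcongr; exact X.le_of_opNorm_le hX1.le _
        _ = ‖x‖ ^ 2 := by ring
    exact mul_nonneg (Real.sqrt_nonneg _) (sub_nonneg.2 this)
  · rw [smul_mul_smul_comm, Real.mul_self_sqrt hM.le, hXX]

/-! ### Square roots of everywhere defined operators -/

theorem adjoint_everywhere (A : V →L[ℝ] V) :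
    (everywhere (A : V →ₗ[ℝ] V)).adjoint = everywhere ((star A : V →L[ℝ] V) : V →ₗ[ℝ] V) :=
  toPMap_adjoint_eq_adjoint_toPMap_of_dense A (p := ⊤) (by simp)

theorem isNonnegSqrt_everywhere {R A : V →L[ℝ] V} (hR : IsSelfAdjoint R)
    (hpos : ∀ x, 0 ≤ inner ℝ x (R x)) (h : R * R = A) :
    IsNonnegSqrt (everywhere (R : V →ₗ[ℝ] V)) (everywhere (A : V →ₗ[ℝ] V)) where
  selfAdjoint := by
    rw [LinearPMap.isSelfAdjoint_def, adjoint_everywhere, hR.star_eq]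
  nonneg x := hpos x
  mul_self := by rw [opMul_everywhere, ← h]; rfl

/-- A square root of an everywhere defined operator is bounded, by the Hellinger-Toeplitz
theorem. -/
theorem IsNonnegSqrt.exists_eq_everywhere {R : V →ₗ.[ℝ] V} {A : V →L[ℝ] V}
    (h : IsNonnegSqrt R (everywhere (A : V →ₗ[ℝ] V))) :
    ∃ B : V →L[ℝ] V, R = everywhere (B : V →ₗ[ℝ] V) ∧ IsSelfAdjoint B ∧
      (∀ x, 0 ≤ inner ℝ x (B x)) ∧ B * B = A := by
  have hdom : ∀ x, x ∈ R.domain := fun x => by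
    have hx : x ∈ (opMul R R).domain := by rw [h.mul_self]; trivial
    exact ((mem_opMul_domain _ _ _).1 hx).1
  let B₀ : V →ₗ[ℝ] V := R.toFun ∘ₗ LinearMap.id.codRestrict R.domain hdom
  have hB₀ : R = everywhere B₀ := eq_everywhere fun x => ⟨hdom x, rfl⟩
  have hdense : Dense (R.domain : Set V) := h.selfAdjoint.dense_domain
  have hadj : R.adjoint = R := h.selfAdjoint
  have hsymm : B₀.IsSymmetric := fun x y => by
    have := LinearPMap.adjoint_isFormalAdjoint hdense
    rw [hadj] at this
    exact this ⟨x, hdom x⟩ ⟨y, hdom y⟩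
  let B : V →L[ℝ] V := ⟨B₀, hsymm.continuous⟩
  refine ⟨B, hB₀, isSelfAdjoint_iff_isSymmetric.2 hsymm, fun x => h.nonneg ⟨x, hdom x⟩, ?_⟩
  have h1 := h.mul_self
  rw [hB₀, opMul_everywhere] at h1
  exact ContinuousLinearMap.coe_injective (everywhere_injective h1)

/-- The root picked by choice is bounded, hence equal to `R` by uniqueness; invertibility of `R`
supplies the coercivity. -/
theorem opSqrt_everywhere {R A : V →L[ℝ] V} (hR : IsSelfAdjoint R)
    (hpos : ∀ x, 0 ≤ inner ℝ x (R x)) (hu : IsUnit R) (h : R * R = A) :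
    opSqrt (everywhere (A : V →ₗ[ℝ] V)) = everywhere (R : V →ₗ[ℝ] V) := by
  have hex : ∃ R, IsNonnegSqrt R (everywhere (A : V →ₗ[ℝ] V)) :=
    ⟨_, isNonnegSqrt_everywhere hR hpos h⟩
  rw [opSqrt, dif_pos hex]
  obtain ⟨B, hB, hBs, hBpos, hBB⟩ := hex.choose_spec.exists_eq_everywhere
  obtain ⟨c, hc, hcoer⟩ := exists_coercive_of_isUnit hR hpos hu
  rw [hB, eq_of_sq_eq hR hBs hc hcoer hBpos (h.trans hBB.symm)]

/-! ### Polar decompositions of invertible operators -/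

theorem isPolarDecomposition_everywhere {A U R : V →L[ℝ] V} (hR : IsSelfAdjoint R)
    (hpos : ∀ x, 0 ≤ inner ℝ x (R x)) (hu : IsUnit R) (hRR : R * R = star A * A)
    (hU : star U * U = 1) (hA : A = U * R) :
    IsPolarDecomposition (everywhere (A : V →ₗ[ℝ] V)) U (everywhere (R : V →ₗ[ℝ] V)) where
  isSqrt := by
    rw [adjoint_everywhere, opMul_everywhere]
    exact isNonnegSqrt_everywhere hR hpos hRR
  partialIsometry x _ := by
    have h1 : inner ℝ (U x) (U x) = inner ℝ x x := by
      rw [← adjoint_inner_left, ← star_eq_adjoint]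
      change inner ℝ ((star U * U) x) x = _
      rw [hU]
      rfl
    rw [real_inner_self_eq_norm_sq, real_inner_self_eq_norm_sq] at h1
    exact (sq_eq_sq₀ (norm_nonneg _) (norm_nonneg _)).1 h1
  ker_eq x := by
    constructor
    · intro hx
      have hx0 : x = 0 := by
        calc x = (star U * U) x := by rw [hU]; rfl
          _ = star U (U x) := rfl
          _ = 0 := by rw [hx, map_zero]
      exact ⟨trivial, (congrArg R hx0).trans (map_zero R)⟩
    · rintro ⟨_, hx⟩
      exact (congrArg U (eq_zero_of_isUnit hu hx)).trans (map_zero U)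
  eq_mul := by
    rw [opMul_everywhere, hA]
    rfl

theorem IsPolarDecomposition.eq_mul_of_everywhere {A U R : V →L[ℝ] V}
    (h : IsPolarDecomposition (everywhere (A : V →ₗ[ℝ] V)) U (everywhere (R : V →ₗ[ℝ] V))) :
    A = U * R := by
  have h1 := h.eq_mul
  rw [opMul_everywhere] at h1
  exact ContinuousLinearMap.coe_injective (everywhere_injective h1)

/-- The absolute value of an invertible self-adjoint operator. -/
theorem exists_abs {D : V →L[ℝ] V} (hD : IsSelfAdjoint D) (hu : IsUnit D) :
    ∃ T : V →L[ℝ] V, IsSelfAdjoint T ∧ (∀ x, 0 ≤ inner ℝ x (T x)) ∧ IsUnit T ∧ T * T = D * D ∧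
      ∀ X, D * D * X = X * (D * D) → T * X = X * T := by
  have hDD : IsSelfAdjoint (D * D) := by simpa [pow_two] using hD.pow 2
  have hpos : ∀ x, 0 ≤ inner ℝ x ((D * D) x) := fun x => by
    change 0 ≤ inner ℝ x (D (D x))
    rw [← inner_apply_left hD]
    exact real_inner_self_nonneg
  obtain ⟨c, hc, hcoer⟩ := exists_coercive_of_isUnit hDD hpos (hu.mul hu)
  obtain ⟨T, hT, hTpos, hTT⟩ := exists_sqrt_of_coercive hDD hc hcoer
  have hTu : IsUnit T := ((Commute.refl T).isUnit_mul_iff.1 (hTT ▸ hu.mul hu)).1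
  obtain ⟨c', hc', hcoer'⟩ := exists_coercive_of_isUnit hT hTpos hTu
  exact ⟨T, hT, hTpos, hTu, hTT, fun X hX => commute_of_commute_sq hT hc' hcoer' (by rwa [hTT])⟩

/-- If `D = J T` with `D`, `T` self-adjoint, `T` invertible, `T² = D²` and `T` commuting with `D`,
then `J` is a self-adjoint involution. -/
theorem isSelfAdjoint_and_mul_self_of_eq_mul {D J T : V →L[ℝ] V} (hD : IsSelfAdjoint D)
    (hT : IsSelfAdjoint T) (hu : IsUnit T) (hTT : T * T = D * D) (hTD : T * D = D * T)
    (hJ : D = J * T) : IsSelfAdjoint J ∧ J * J = 1 := by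
  have hTJ : T * J = J * T := by
    apply hu.mul_right_cancel
    rw [mul_assoc, ← hJ, hTD]
  constructor
  · have h1 : T * star J = D := by
      rw [← hD.star_eq, hJ, star_mul, hT.star_eq]
    exact hu.mul_left_cancel (by rw [h1, hTJ, ← hJ])
  · apply (hu.mul hu).mul_right_cancel
    calc J * J * (T * T) = J * (J * T) * T := by noncomm_ring
      _ = J * (T * J) * T := by rw [hTJ]
      _ = (J * T) * (J * T) := by noncomm_ring
      _ = 1 * (T * T) := by rw [← hJ, hTT, one_mul]

/-! ### Pairs of complementary subspaces -/

variable (K : ClosedSubmodule ℝ V)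

theorem proj_apply_of_mem {x : V} (hx : x ∈ K.toSubmodule) : proj K x = x :=
  Submodule.starProjection_eq_self_iff.2 hx

theorem proj_apply_mem (x : V) : proj K x ∈ K.toSubmodule :=
  Submodule.starProjection_apply_mem _ x

theorem isSelfAdjoint_proj : IsSelfAdjoint (proj K) :=
  isSelfAdjoint_starProjection _

theorem proj_mul_proj : proj K * proj K = proj K := by
  ext x
  exact proj_apply_of_mem K (proj_apply_mem K x)

/-- `S` is the difference of the two oblique projections, which are bounded because both subspaces
are closed. -/
theorem continuous_opS {K L : ClosedSubmodule ℝ V}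
    (h : IsCompl K.toSubmodule L.toSubmodule) : Continuous (opS K L h) := by
  have hc := Submodule.IsCompl.isTopCompl_of_isClosed h K.isClosed L.isClosed
  have : opS K L h = ((K.toSubmodule.projectionL L.toSubmodule hc -
      L.toSubmodule.projectionL K.toSubmodule hc.symm : V →L[ℝ] V) : V →ₗ[ℝ] V) := by
    refine LinearMap.ofIsCompl_eq h (fun u => ?_) fun v => ?_
    · simp
    · simp
  rw [this]
  exact ContinuousLinearMap.continuous _

end SubspacePair
end

open SubspacePair

theorem mainTheorem5 {V : Type*} [NormedAddCommGroup V] [InnerProductSpace ℝ V] [CompleteSpace V]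
    (K L : ClosedSubmodule ℝ V) (h : IsCompl K.toSubmodule L.toSubmodule)
    (P Q J : V →L[ℝ] V) (T Δ : V →ₗ.[ℝ] V) (S : V →ₗ[ℝ] V)
    (hP : P = proj K) (hQ : Q = proj L) (hT : T = opT K L) (hJ : J = opJ K L)
    (hΔ : Δ = opDelta K L) (hS : S = opS K L h) :
    -- `T` and `J` really are the factors of the polar decomposition of `P - Q`
    IsPolarDecomposition (everywhere ((P - Q : V →L[ℝ] V) : V →ₗ[ℝ] V)) J T ∧
    -- (a)
    (S ∘ₗ (P : V →ₗ[ℝ] V) = P ∧ S ∘ₗ (Q : V →ₗ[ℝ] V) = -(Q : V →ₗ[ℝ] V)) ∧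
    -- (b)
    (S ∘ₗ ((P + Q : V →L[ℝ] V) : V →ₗ[ℝ] V) = ((P - Q : V →L[ℝ] V) : V →ₗ[ℝ] V) ∧
      S ∘ₗ ((P - Q : V →L[ℝ] V) : V →ₗ[ℝ] V) = ((P + Q : V →L[ℝ] V) : V →ₗ[ℝ] V)) ∧
    -- (c) `S* S = Δ`, with equality of domains
    opMul (everywhere S).adjoint (everywhere S) = Δ ∧
    -- (d)
    ((2 - (P + Q) : V →L[ℝ] V) : V →ₗ[ℝ] V) ∘ₗ S = ((P - Q : V →L[ℝ] V) : V →ₗ[ℝ] V) ∧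
    -- (e) `S* J = J S`, with equality of domains
    opMul (everywhere S).adjoint (everywhere (J : V →ₗ[ℝ] V)) =
      opMul (everywhere (J : V →ₗ[ℝ] V)) (everywhere S) ∧
    -- (f) the polar decomposition of `S` is `S = J Δ^{1/2}`
    (IsNonnegSqrt (opSqrt Δ) Δ ∧ IsPolarDecomposition (everywhere S) J (opSqrt Δ)) := by
  obtain ⟨S', hS'⟩ : ∃ S' : V →L[ℝ] V, S = (S' : V →ₗ[ℝ] V) :=
    ⟨⟨S, hS ▸ continuous_opS h⟩, rfl⟩
  have hSK : ∀ y ∈ K.toSubmodule, S' y = y := fun y hy => by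
    refine Eq.trans ?_ (opS_apply_left h hy)
    rw [← hS, hS']
    rfl
  have hSL : ∀ z ∈ L.toSubmodule, S' z = -z := fun z hz => by
    rw [← opS_apply_right h hz, ← hS, hS']
    rfl
  have hPs : IsSelfAdjoint P := hP ▸ isSelfAdjoint_proj K
  have hQs : IsSelfAdjoint Q := hQ ▸ isSelfAdjoint_proj L
  have hPP : P * P = P := hP ▸ proj_mul_proj K
  have hQQ : Q * Q = Q := hQ ▸ proj_mul_proj L
  have hPK : ∀ y ∈ K.toSubmodule, P y = y := fun y hy => hP ▸ proj_apply_of_mem K hy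
  have hQL : ∀ z ∈ L.toSubmodule, Q z = z := fun z hz => hQ ▸ proj_apply_of_mem L hz
  have hSP : S' * P = P := by
    ext x
    exact hSK _ (hP ▸ proj_apply_mem K x)
  have hSQ : S' * Q = -Q := by
    ext x
    exact hSL _ (hQ ▸ proj_apply_mem L x)
  have hSadd : S' * (P + Q) = P - Q := by rw [mul_add, hSP, hSQ, sub_eq_add_neg]
  have hSsub : S' * (P - Q) = P + Q := by rw [mul_sub, hSP, hSQ, sub_neg_eq_add]
  have two_apply : ∀ x : V, (2 : V →L[ℝ] V) x = x + x := fun x => by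
    rw [← one_add_one_eq_two]
    rfl
  have hd : (2 - (P + Q)) * S' = P - Q := by
    refine continuousLinearMap_ext_of_isCompl h (fun y hy => ?_) fun z hz => ?_
    · change (2 - (P + Q)) (S' y) = (P - Q) y
      simp only [hSK y hy, sub_apply, add_apply,
        hPK y hy, two_apply]
      abel
    · change (2 - (P + Q)) (S' z) = (P - Q) z
      simp only [hSL z hz, sub_apply, add_apply, map_neg,
        hQL z hz, two_apply]
      abel
  have hd' : (P - Q) * S' = 2 - (P + Q) := by
    refine continuousLinearMap_ext_of_isCompl h (fun y hy => ?_) fun z hz => ?_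
    · change (P - Q) (S' y) = (2 - (P + Q)) y
      simp only [hSK y hy, sub_apply, add_apply,
        hPK y hy, two_apply]
      abel
    · change (P - Q) (S' z) = (2 - (P + Q)) z
      simp only [hSL z hz, sub_apply, add_apply, map_neg,
        hQL z hz, two_apply]
      abel
  have hSS : S' * S' = 1 := by
    refine continuousLinearMap_ext_of_isCompl h (fun y hy => ?_) fun z hz => ?_
    · change S' (S' y) = y
      rw [hSK y hy, hSK y hy]
    · change S' (S' z) = z
      rw [hSL z hz, map_neg, hSL z hz, neg_neg]
  have hDs : IsSelfAdjoint (P - Q) := hPs.sub hQs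
  have hAs : IsSelfAdjoint (P + Q) := hPs.add hQs
  have h2s : IsSelfAdjoint (2 - (P + Q)) := (IsSelfAdjoint.ofNat 2).sub hAs
  have hS2 : star S' * (2 - (P + Q)) = P - Q := by
    simpa only [star_mul, hDs.star_eq, h2s.star_eq] using congrArg star hd
  have hSD : star S' * (P - Q) = 2 - (P + Q) := by
    simpa only [star_mul, hDs.star_eq, h2s.star_eq] using congrArg star hd'
  have hAS : (P + Q) * star S' = P - Q := by
    simpa only [star_mul, hDs.star_eq, hAs.star_eq] using congrArg star hSadd
  have hSSA : star S' * S' * (P + Q) = 2 - (P + Q) := by rw [mul_assoc, hSadd, hSD]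
  have hASS : (P + Q) * (star S' * S') = 2 - (P + Q) := by rw [← mul_assoc, hAS, hd']
  have h2 : (2 : V →L[ℝ] V) = (2 : ℝ) • 1 := by rw [two_smul, one_add_one_eq_two]
  -- `P + Q` is invertible, with inverse `(1 + S* S) / 2`
  have hr : (P + Q) * ((2⁻¹ : ℝ) • (1 + star S' * S')) = 1 := by
    rw [mul_smul_comm, mul_add, hASS, mul_one, add_sub_cancel, h2, smul_smul,
      inv_mul_cancel₀ two_ne_zero, one_smul]
  have hl : ((2⁻¹ : ℝ) • (1 + star S' * S')) * (P + Q) = 1 := by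
    rw [smul_mul_assoc, add_mul, hSSA, one_mul, add_sub_cancel, h2, smul_smul,
      inv_mul_cancel₀ two_ne_zero, one_smul]
  set B : V →L[ℝ] V := (2⁻¹ : ℝ) • (1 + star S' * S')
  have hAu : IsUnit (P + Q) := ⟨⟨P + Q, B, hr, hl⟩, rfl⟩
  have hSu : IsUnit S' := ⟨⟨S', S', hSS, hSS⟩, rfl⟩
  have hDu : IsUnit (P - Q) := hSadd ▸ hSu.mul hAu
  -- the polar decomposition of `P - Q`
  obtain ⟨T', hTs, hTpos, hTu, hTT, hTcomm⟩ := exists_abs hDs hDu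
  have hTeq : T = everywhere (T' : V →ₗ[ℝ] V) := by
    rw [hT, opT, ← hP, ← hQ]
    exact opSqrt_everywhere hTs hTpos hTu (by rw [hTT, pow_two])
  have hTD : T' * (P - Q) = (P - Q) * T' := hTcomm _ (mul_assoc _ _ _)
  -- Rules out the default value `0` in `opJ`; the witness is `(P - Q) T⁻¹`.
  have hJex : ∃ U, IsPolarDecomposition (everywhere ((P - Q : V →L[ℝ] V) : V →ₗ[ℝ] V)) U T := by
    obtain ⟨C, hC⟩ := hTu.exists_left_inv
    have hU : P - Q = (P - Q) * C * T' := by rw [mul_assoc, hC, mul_one]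
    obtain ⟨hUs, hUU⟩ := isSelfAdjoint_and_mul_self_of_eq_mul hDs hTs hTu hTT hTD hU
    refine ⟨(P - Q) * C, ?_⟩
    rw [hTeq]
    exact isPolarDecomposition_everywhere hTs hTpos hTu (by rw [hDs.star_eq, hTT])
      (by rw [hUs.star_eq, hUU]) hU
  have hpolar : IsPolarDecomposition (everywhere ((P - Q : V →L[ℝ] V) : V →ₗ[ℝ] V)) J T := by
    have hJ' := hJ
    rw [opJ, ← hP, ← hQ, ← hT, dif_pos hJex] at hJ'
    rw [hJ']
    exact hJex.choose_spec
  have hDJT : P - Q = J * T' := (hTeq ▸ hpolar).eq_mul_of_everywhere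
  obtain ⟨hJs, hJJ⟩ := isSelfAdjoint_and_mul_self_of_eq_mul hDs hTs hTu hTT hTD hDJT
  have hJD : J * (P - Q) = T' := by rw [hDJT, ← mul_assoc, hJJ, one_mul]
  have hDJ : (P - Q) * J = T' := by
    simpa only [star_mul, hDs.star_eq, hJs.star_eq, hTs.star_eq] using congrArg star hJD
  -- `T` commutes with `P` and `Q`
  have hDD : (P - Q) * (P - Q) = P - P * Q - Q * P + Q := by
    rw [mul_sub, sub_mul, sub_mul, hPP, hQQ]
    abel
  -- Both products of `P` with `(P - Q)²` equal `P - P Q P`.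
  have hTP : T' * P = P * T' := hTcomm P (by
    simp only [hDD, sub_mul, add_mul, mul_sub, mul_add, ← mul_assoc, hPP]
    simp only [mul_assoc, hPP]
    abel)
  have hTQ : T' * Q = Q * T' := hTcomm Q (by
    simp only [hDD, sub_mul, add_mul, mul_sub, mul_add, ← mul_assoc, hQQ]
    simp only [mul_assoc, hQQ]
    abel)
  -- After multiplying by `T` on the right this reads `(2 - (P + Q)) (P - Q) = (P - Q) (P + Q)`.
  have hJA : (2 - (P + Q)) * J = J * (P + Q) := by
    apply hTu.mul_right_cancel
    have h1 : (P + Q) * T' = T' * (P + Q) := by rw [mul_add, add_mul, hTP, hTQ]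
    rw [mul_assoc, ← hDJT, mul_assoc, h1, ← mul_assoc, ← hDJT]
    simp only [sub_mul, add_mul, mul_sub, mul_add, two_mul, hPP, hQQ]
    abel
  have he : star S' * J = J * S' := by
    apply hAu.mul_right_cancel
    rw [mul_assoc, ← hJA, ← mul_assoc, hS2, mul_assoc, hSadd, hDJ, hJD]
  have hΔeq : Δ = everywhere ((star S' * S' : V →L[ℝ] V) : V →ₗ[ℝ] V) := by
    have h1 : (2 - (P + Q)) * B = star S' * S' := by rw [← hSSA, mul_assoc, hr, mul_one]
    rw [hΔ, opDelta, ← hP, ← hQ, inverse_everywhere hr hl, opMul_everywhere, ← h1]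
    rfl
  -- `J S` is the square root of `S* S`
  have hRs : IsSelfAdjoint (J * S') := by
    rw [IsSelfAdjoint, star_mul, hJs.star_eq, he]
  have hRR : (J * S') * (J * S') = star S' * S' := by
    nth_rw 1 [← he]
    rw [mul_assoc, ← mul_assoc J, hJJ, one_mul]
  have hRu : IsUnit (J * S') := IsUnit.mul ⟨⟨J, J, hJJ, hJJ⟩, rfl⟩ hSu
  -- For `x = (P + Q) w` the form is `⟨P w, T w⟩ + ⟨Q w, T w⟩ = ⟨P w, T P w⟩ + ⟨Q w, T Q w⟩`.
  have hRpos : ∀ x, 0 ≤ inner ℝ x ((J * S') x) := fun x => by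
    have hx : x = (P + Q) (B x) := by
      change x = ((P + Q) * B) x
      rw [hr]
      rfl
    have hpos : ∀ {E : V →L[ℝ] V}, IsSelfAdjoint E → E * E = E → T' * E = E * T' → ∀ w,
        0 ≤ inner ℝ (E w) (T' w) := fun {E} hE hEE hTE w => by
      have h1 : E (T' w) = T' (E w) := congrArg (fun A : V →L[ℝ] V => A w) hTE.symm
      have h2 : E (E w) = E w := congrArg (fun A : V →L[ℝ] V => A w) hEE
      rw [← h2, inner_apply_left hE, h1]
      exact hTpos _
    have h1 : (J * S') x = T' (B x) := by
      nth_rw 1 [hx]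
      change (J * S' * (P + Q)) (B x) = _
      rw [mul_assoc, hSadd, hJD]
    rw [h1]
    nth_rw 1 [hx]
    rw [add_apply, inner_add_left]
    exact add_nonneg (hpos hPs hPP hTP _) (hpos hQs hQQ hTQ _)
  have hsqrt : opSqrt Δ = everywhere ((J * S' : V →L[ℝ] V) : V →ₗ[ℝ] V) := by
    rw [hΔeq]
    exact opSqrt_everywhere hRs hRpos hRu hRR
  refine ⟨hpolar, ⟨?_, ?_⟩, ⟨?_, ?_⟩, ?_, ?_, ?_, ?_, ?_⟩
  · rw [hS']
    exact congrArg (fun A : V →L[ℝ] V => (A : V →ₗ[ℝ] V)) hSP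
  · rw [hS']
    exact congrArg (fun A : V →L[ℝ] V => (A : V →ₗ[ℝ] V)) hSQ
  · rw [hS']
    exact congrArg (fun A : V →L[ℝ] V => (A : V →ₗ[ℝ] V)) hSadd
  · rw [hS']
    exact congrArg (fun A : V →L[ℝ] V => (A : V →ₗ[ℝ] V)) hSsub
  · rw [hS', adjoint_everywhere, opMul_everywhere, hΔeq]
    rfl
  · rw [hS']
    exact congrArg (fun A : V →L[ℝ] V => (A : V →ₗ[ℝ] V)) hd
  · rw [hS', adjoint_everywhere, opMul_everywhere, opMul_everywhere]
    exact congrArg (fun A : V →L[ℝ] V => everywhere (A : V →ₗ[ℝ] V)) he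
  · rw [hsqrt, hΔeq]
    exact isNonnegSqrt_everywhere hRs hRpos hRR
  · rw [hsqrt, hS']
    exact isPolarDecomposition_everywhere hRs hRpos hRu hRR (by rw [hJs.star_eq, hJJ])
      (by rw [← mul_assoc, hJJ, one_mul])
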